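/- Notation. Put $\hat f(\xi)=\int_{\mathbb R}f(x)e^{-2\pi i\xi x}\,dx$ and identify $\mathbb T=\mathbb R/\mathbb Z$ with $[0,1)$. For $1\le p<\infty$: - $M_p(\mathbb R)$ is the space of Fourier multipliers of $L^p(\mathbb R)$, i.e. of $m\in L^\infty(\mathbb R)$ for which $f\mapsto (m\hat f)^\vee$ (on Schwartz functions) is bounded in the $L^p(\mathbb R)$ norm; - $M_p(\mathbb Z)$ is the space of Fourier multipliers of $L^p(\mathbb T)$, i.e. of sequences $\phi:\mathbb Z\to\mathbb C$ for which there is a constant $C$ such that for every $f\in L^p(\mathbb T)$ the sequence $\phi\hat f$ is the sequence of Fourier coefficients of some $g\in L^p(\mathbb T)$ with $\|g\|_p\le C\|f\|_p$; - $M_p(\mathbb T)$ is the space of Fourier multipliers of $\ell^p(\mathbb Z)$, i.e. of $m\in L^\infty(\mathbb T)$ for which the operator $(T_ma)(n)=\int_{\mathbb T}m(\xi)\big(\sum_k a(k)e^{-2\pi ik\xi}\big)e^{2\pi in\xi}\,d\xi$ (on finitely supported sequences $a$) is bounded in the $\ell^p(\mathbb Z)$ norm. Each space carries the corresponding operator norm.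 Series over $\mathbb Z$ are understood as limits of the symmetric partial sums $\sum_{|n|\le N}$. A measurable function $\Lambda:\mathbb R\to\mathbb C$ is a *summability kernel for $L^p(\mathbb R)$ multipliers*, $\Lambda\in S_p(\mathbb R)$, if for each $\phi\in M_p(\mathbb Z)$ the series $W_{\phi,\Lambda}(\xi)=\sum_{n\in\mathbb Z}\phi(n)\Lambda(\xi-n)$ converges for a.e. $\xi$ and belongs to $M_p(\mathbb R)$, and there is a constant $C_{p,\Lambda}$, independent of $\phi$, such that $\|W_{\phi,\Lambda}\|_{M_p(\mathbb R)}\le C_{p,\Lambda}\|\phi\|_{M_p(\mathbb Z)}$ for all $\phi\in M_p(\mathbb Z)$. For $x\in\mathbb R$ put $\Lambda_x(\xi)=e^{2\pi ix\xi}\Lambda(\xi)$ and $\Lambda_x^\#(\xi)=\sum_{n\in\mathbb Z}\Lambda_x(\xi+n)$. For $1\le p\le2$ let $\mathcal F_p$ be the set of all $\Lambda\in L^\infty(\mathbb R)$ such that for a.e. $x\in[0,1)$ the series defining $\Lambda_x^\#(\xi)$ converges for a.e. $\xi\in\mathbb R$ to an a.e. 1-periodic function which belongs to $M_p(\mathbb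 T)$, and such that the function $x\mapsto\|\Lambda_x^\#\|_{M_p(\mathbb T)}$ belongs to $L^\infty[0,1)$. **Proposition.** For $1\le p\le 2$, $S_p(\mathbb R)\subseteq\mathcal F_p$. -/

import Mathlib

open MeasureTheory Filter Topology
open scoped ENNReal NNReal FourierTransform SchwartzMap

noncomputable section

namespace SummabilityKernels

/-! ### Fourier multipliers for `L^p(ℝ)` -/

/-- `C` bounds on `L^p(ℝ)` the operator `f ↦ (m f̂)ˇ` with symbol `m`, tested on the (dense) class of
Schwartz functions. Here `f̂(ξ) = ∫ f(x) e^{-2πixξ} dx`. -/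
def RealMultiplierBound (p : ℝ≥0∞) (m : ℝ → ℂ) (C : ℝ≥0) : Prop :=
  ∀ f : 𝓢(ℝ, ℂ),
    eLpNorm (𝓕⁻ (fun ξ : ℝ => m ξ * 𝓕 (f : ℝ → ℂ) ξ)) p volume
      ≤ (C : ℝ≥0∞) * eLpNorm (f : ℝ → ℂ) p volume

/-- `M_p(ℝ)`: the essentially bounded symbols of bounded Fourier multiplier operators
on `L^p(ℝ)`. -/
def RealMultiplier (p : ℝ≥0∞) : Set (ℝ → ℂ) :=
  {m | MemLp m ∞ volume ∧ ∃ C : ℝ≥0, RealMultiplierBound p m C}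

/-- The norm of `M_p(ℝ)`: the operator norm on `L^p(ℝ)`. -/
def realMultiplierNorm (p : ℝ≥0∞) (m : ℝ → ℂ) : ℝ≥0 :=
  sInf {C | RealMultiplierBound p m C}

/-! ### Fourier multipliers for `L^p(𝕋)`; their symbols are functions on `ℤ` -/

/-- For every `f ∈ L^p(𝕋)`, the sequence `φ f̂` is the sequence of Fourier coefficients of some
`g ∈ L^p(𝕋)` with `‖g‖_p ≤ C ‖f‖_p`. -/
def IntMultiplierBound (p : ℝ≥0∞) (φ : ℤ → ℂ) (C : ℝ≥0) : Prop :=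
  ∀ f : UnitAddCircle → ℂ, MemLp f p AddCircle.haarAddCircle →
    ∃ g : UnitAddCircle → ℂ, MemLp g p AddCircle.haarAddCircle ∧
      (∀ n : ℤ, fourierCoeff g n = φ n * fourierCoeff f n) ∧
      eLpNorm g p AddCircle.haarAddCircle
        ≤ (C : ℝ≥0∞) * eLpNorm f p AddCircle.haarAddCircle

/-- `M_p(ℤ)`: the symbols (on `ℤ`) of the bounded Fourier multiplier operators on `L^p(𝕋)`. -/
def IntMultiplier (p : ℝ≥0∞) : Set (ℤ → ℂ) :=
  {φ | ∃ C : ℝ≥0, IntMultiplierBound p φ C}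

/-- The norm of `M_p(ℤ)`: the operator norm on `L^p(𝕋)`. -/
def intMultiplierNorm (p : ℝ≥0∞) (φ : ℤ → ℂ) : ℝ≥0 :=
  sInf {C | IntMultiplierBound p φ C}

/-! ### Fourier multipliers for `ℓ^p(ℤ)`; their symbols are functions on `𝕋` -/

/-- The Fourier series `â(ξ) = ∑ₖ a(k) e^{-2πikξ}` of a finitely supported sequence. -/
def seqFourier (a : ℤ →₀ ℂ) (ξ : UnitAddCircle) : ℂ :=
  a.sum fun k c => c * fourier (-k) ξ

/-- The multiplier operator on sequences with symbol `m` on `𝕋`: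
`(T_m a)(n) = ∫_𝕋 m(ξ) â(ξ) e^{2πinξ} dξ`. -/
def seqMultiplierOp (m : UnitAddCircle → ℂ) (a : ℤ →₀ ℂ) (n : ℤ) : ℂ :=
  ∫ ξ : UnitAddCircle, m ξ * seqFourier a ξ * fourier n ξ ∂AddCircle.haarAddCircle

/-- `C` bounds `T_m` on `ℓ^p(ℤ)`, tested on the (dense) class of finitely supported sequences. -/
def CircleMultiplierBound (p : ℝ≥0∞) (m : UnitAddCircle → ℂ) (C : ℝ≥0) : Prop :=
  ∀ a : ℤ →₀ ℂ,
    eLpNorm (seqMultiplierOp m a) p Measure.count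
      ≤ (C : ℝ≥0∞) * eLpNorm (a : ℤ → ℂ) p Measure.count

/-- `M_p(𝕋)`: the essentially bounded symbols (on `𝕋`) of the bounded Fourier multiplier operators
on `ℓ^p(ℤ)`. -/
def CircleMultiplier (p : ℝ≥0∞) : Set (UnitAddCircle → ℂ) :=
  {m | MemLp m ∞ AddCircle.haarAddCircle ∧ ∃ C : ℝ≥0, CircleMultiplierBound p m C}

/-- The norm of `M_p(𝕋)`: the operator norm on `ℓ^p(ℤ)`. -/
def circleMultiplierNorm (p : ℝ≥0∞) (m : UnitAddCircle → ℂ) : ℝ≥0 :=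
  sInf {C | CircleMultiplierBound p m C}

/-! ### Summability kernels -/

/-- The partial sum `∑_{|n| ≤ N} φ(n) Λ(ξ - n)`. -/
def kernelPartialSum (φ : ℤ → ℂ) (Λ : ℝ → ℂ) (N : ℕ) (ξ : ℝ) : ℂ :=
  ∑ n ∈ Finset.Icc (-(N : ℤ)) (N : ℤ), φ n * Λ (ξ - n)

/-- `W_{φ,Λ}(ξ) = ∑_{n ∈ ℤ} φ(n) Λ(ξ - n)`, meaningful where the series converges. -/
def kernelSeries (φ : ℤ → ℂ) (Λ : ℝ → ℂ) (ξ : ℝ) : ℂ :=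
  limUnder atTop fun N : ℕ => kernelPartialSum φ Λ N ξ

/-- `S_p(ℝ)`: the summability kernels for `L^p(ℝ)` multipliers. -/
def SummabilityKernel (p : ℝ≥0∞) : Set (ℝ → ℂ) :=
  {Λ | AEStronglyMeasurable Λ volume ∧
    (∀ φ ∈ IntMultiplier p,
      (∀ᵐ ξ : ℝ, ∃ w : ℂ, Tendsto (fun N : ℕ => kernelPartialSum φ Λ N ξ) atTop (𝓝 w)) ∧
      kernelSeries φ Λ ∈ RealMultiplier p) ∧
    ∃ C : ℝ≥0, ∀ φ ∈ IntMultiplier p,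
      realMultiplierNorm p (kernelSeries φ Λ) ≤ C * intMultiplierNorm p φ}

/-! ### Periodization and the class `F_p` -/

/-- The modulation `Λ_x(ξ) = e^{2πixξ} Λ(ξ)`. -/
def modulate (x : ℝ) (Λ : ℝ → ℂ) (ξ : ℝ) : ℂ :=
  Complex.exp (2 * Real.pi * Complex.I * x * ξ) * Λ ξ

/-- The partial sum `∑_{|n| ≤ N} g(ξ + n)`. -/
def periodizationPartialSum (g : ℝ → ℂ) (N : ℕ) (ξ : ℝ) : ℂ :=
  ∑ n ∈ Finset.Icc (-(N : ℤ)) (N : ℤ), g (ξ + n)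

/-- The periodization `g^#(ξ) = ∑_{n ∈ ℤ} g(ξ + n)`, as a function on `𝕋 ≅ [0,1)`. -/
def periodization (g : ℝ → ℂ) : UnitAddCircle → ℂ :=
  AddCircle.liftIco 1 0 fun ξ : ℝ => limUnder atTop fun N : ℕ => periodizationPartialSum g N ξ

/-- The series `∑_{n ∈ ℤ} g(ξ + n)` converges for a.e. `ξ ∈ ℝ`, and its sum is a.e. the
1-periodic function given by `periodization g`. -/
def HasPeriodization (g : ℝ → ℂ) : Prop :=
  ∀ᵐ ξ : ℝ, Tendsto (fun N : ℕ => periodizationPartialSum g N ξ) atTop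
    (𝓝 (periodization g (ξ : UnitAddCircle)))

/-- The class `F_p`: all `Λ ∈ L^∞(ℝ)` such that for a.e. `x ∈ [0,1)` the periodization `Λ_x^#`
exists and lies in `M_p(𝕋)`, with `x ↦ ‖Λ_x^#‖_{M_p(𝕋)}` in `L^∞[0,1)`. -/
def FClass (p : ℝ≥0∞) : Set (ℝ → ℂ) :=
  {Λ | MemLp Λ ∞ volume ∧
    (∀ᵐ x ∂(volume.restrict (Set.Ico (0 : ℝ) 1)),
      HasPeriodization (modulate x Λ) ∧
      periodization (modulate x Λ) ∈ CircleMultiplier p) ∧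
    MemLp (fun x : ℝ => (circleMultiplierNorm p (periodization (modulate x Λ)) : ℝ)) ∞
      (volume.restrict (Set.Ico (0 : ℝ) 1))}

end SummabilityKernels

end

noncomputable section

namespace SummabilityKernels

/-! ### The circle as a quotient of the line -/

/-! Testing the kernel on a character of `ℤ` produces a periodization. With `φ(n) = e^{-2πixn}`,
substituting `n ↦ -n` gives `Λ_x^#(ξ) = e^{2πixξ} W_{φ,Λ}(ξ)`. As a multiplier on `L^p(𝕋)`, `φ` is a
translation, so it has norm at most 1; multiplying a symbol on `ℝ` by `e^{2πixξ}` translates the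
output and changes no norm. Hence `Λ_x^#` is an `L^p(ℝ)` multiplier with a bound independent of `x`,
for every `x`.

De Leeuw's transference (`circleMultiplierBound_of_comp_coe`) carries this bound to `ℓ^p(ℤ)`. For
`f` supported in `(0,1)`, an operator with periodic symbol maps `∑ a(k) f(· - k)` to a function of
the same shape whose coefficients are `T_m a`, and the norm of `f` cancels.

Two points need separate care. Symmetric summation need not give a periodic limit: shifting `ξ` by 1
changes the partial sums by boundary terms, which vanish in the limit because `Λ(ξ ± N) → 0` a.e.
(`SummabilityKernel.tendsto_translate_zero`). And `x ↦ ‖Λ_x^#‖` must be measurable: the norm is a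
Borel function of the Fourier coefficients of the symbol (`measurable_convolutionNorm`), which
depend measurably on `x`. Boundedness of `Λ` itself comes from testing on `φ = δ₀`. -/

theorem haarAddCircle_eq_volume :
    (AddCircle.haarAddCircle : Measure UnitAddCircle) = volume := by
  rw [AddCircle.volume_eq_smul_haarAddCircle]; simp

theorem measurePreserving_mk_haar (a : ℝ) :
    MeasurePreserving (fun x : ℝ => (x : UnitAddCircle)) (volume.restrict (Set.Ioc a (a + 1)))
      AddCircle.haarAddCircle := by
  rw [haarAddCircle_eq_volume]
  exact UnitAddCircle.measurePreserving_mk a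

/-- The representative in `[0,1)` of a point of the circle. -/
def circleRep (t : UnitAddCircle) : ℝ := (AddCircle.equivIco 1 0 t : ℝ)

theorem measurable_circleRep : Measurable circleRep :=
  measurable_subtype_coe.comp (AddCircle.measurableEquivIco (1 : ℝ) 0).measurable

theorem coe_circleRep (t : UnitAddCircle) : (circleRep t : UnitAddCircle) = t :=
  AddCircle.coe_equivIco

theorem circleRep_coe (x : ℝ) : circleRep (x : UnitAddCircle) = Int.fract x := by
  have := AddCircle.coe_equivIco_mk_apply (1 : ℝ) x
  rwa [div_one, mul_one] at this

theorem liftIco_eq_circleRep (F : ℝ → ℂ) (t : UnitAddCircle) :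
    AddCircle.liftIco 1 0 F t = F (circleRep t) := rfl

theorem measurePreserving_circleRep :
    MeasurePreserving circleRep AddCircle.haarAddCircle
      (volume.restrict (Set.Ioc (0 : ℝ) 1)) := by
  refine ⟨measurable_circleRep, ?_⟩
  have h := measurePreserving_mk_haar 0
  rw [zero_add] at h
  rw [← h.map_eq, Measure.map_map measurable_circleRep h.measurable]
  conv_rhs => rw [← Measure.map_id (μ := volume.restrict (Set.Ioc (0 : ℝ) 1))]
  refine Measure.map_congr ?_
  -- Representatives lie in `[0,1)` while the measure lives on `(0,1]`; the endpoint is null.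
  rw [← restrict_Ioo_eq_restrict_Ioc]
  filter_upwards [ae_restrict_mem measurableSet_Ioo] with x hx
  simpa [circleRep_coe] using Int.fract_eq_self.2 ⟨hx.1.le, hx.2⟩

theorem ae_circle_of_ae_real {P : UnitAddCircle → Prop} (h : ∀ᵐ x : ℝ, P x) :
    ∀ᵐ t ∂(AddCircle.haarAddCircle : Measure UnitAddCircle), P t := by
  have := measurePreserving_circleRep.quasiMeasurePreserving.ae (ae_restrict_of_ae h)
  simpa only [coe_circleRep] using this

theorem ae_real_of_ae_Ioc {Q : ℝ → Prop}
    (h : ∀ n : ℤ, ∀ᵐ x ∂(volume.restrict (Set.Ioc (n : ℝ) (n + 1))), Q x) : ∀ᵐ x : ℝ, Q x := by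
  rw [← Measure.restrict_univ (μ := (volume : Measure ℝ)), ← iUnion_Ioc_intCast ℝ,
    ae_restrict_iUnion_iff]
  exact h

theorem ae_real_of_ae_circle {P : UnitAddCircle → Prop}
    (h : ∀ᵐ t ∂(AddCircle.haarAddCircle : Measure UnitAddCircle), P t) : ∀ᵐ x : ℝ, P x :=
  ae_real_of_ae_Ioc fun n => (measurePreserving_mk_haar n).quasiMeasurePreserving.ae h

theorem integral_haar_eq (G : UnitAddCircle → ℂ) :
    ∫ t, G t ∂AddCircle.haarAddCircle = ∫ x in Set.Ioc (0 : ℝ) 1, G x := by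
  rw [haarAddCircle_eq_volume, ← UnitAddCircle.intervalIntegral_preimage 0 G, zero_add,
    intervalIntegral.integral_of_le zero_le_one]

theorem exists_ae_norm_le_of_eLpNorm_top {α : Type*} [MeasurableSpace α] {μ : Measure α}
    {f : α → ℂ} (h : eLpNorm f ∞ μ < ∞) : ∃ B : ℝ, ∀ᵐ x ∂μ, ‖f x‖ ≤ B := by
  rw [eLpNorm_exponent_top] at h
  refine ⟨(eLpNormEssSup f μ).toReal, (ae_le_eLpNormEssSup (f := f) (μ := μ)).mono fun t ht => ?_⟩
  rw [← toReal_enorm]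
  exact ENNReal.toReal_mono h.ne ht

/-- A bounded function on the circle gives a bounded periodic function on the line. -/
theorem memLp_top_comp_coe {M : UnitAddCircle → ℂ} (hM : MemLp M ∞ AddCircle.haarAddCircle) :
    MemLp (fun ξ : ℝ => M ξ) ∞ volume := by
  obtain ⟨⟨M', hM', hae⟩, hb⟩ := hM
  obtain ⟨B, hB⟩ := exists_ae_norm_le_of_eLpNorm_top hb
  exact memLp_top_of_bound
    ⟨fun ξ => M' ξ, hM'.comp_measurable AddCircle.measurable_mk', ae_real_of_ae_circle hae⟩ B
    (ae_real_of_ae_circle (P := fun t => ‖M t‖ ≤ B) hB)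

/-! ### Fourier transforms of translates -/

theorem fourier_comp_sub (f : ℝ → ℂ) (a ξ : ℝ) :
    𝓕 (fun x => f (x - a)) ξ = Complex.exp (-(2 * Real.pi * Complex.I * a * ξ)) * 𝓕 f ξ := by
  rw [Real.fourier_real_eq_integral_exp_smul, Real.fourier_real_eq_integral_exp_smul,
    ← integral_const_mul, ← integral_add_right_eq_self _ a]
  refine integral_congr_ae (ae_of_all _ fun v => ?_)
  simp only [add_sub_cancel_right, smul_eq_mul, ← mul_assoc, ← Complex.exp_add]
  congr 2
  push_cast
  ring

theorem fourierInv_modulate (h : ℝ → ℂ) (a x : ℝ) :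
    𝓕⁻ (fun ξ : ℝ => Complex.exp (2 * Real.pi * Complex.I * a * ξ) * h ξ) x = 𝓕⁻ h (x + a) := by
  rw [Real.fourierInv_eq', Real.fourierInv_eq']
  refine integral_congr_ae (ae_of_all _ fun v => ?_)
  simp only [smul_eq_mul, ← mul_assoc, ← Complex.exp_add]
  congr 2
  simp
  ring

/-! ### De Leeuw's theorem for periodic symbols -/

theorem fourierInv_eq_integral (h : ℝ → ℂ) (x : ℝ) :
    𝓕⁻ h x = ∫ ξ : ℝ, Complex.exp (2 * Real.pi * Complex.I * x * ξ) * h ξ := by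
  rw [Real.fourierInv_eq']
  refine integral_congr_ae (ae_of_all _ fun v => ?_)
  simp only [smul_eq_mul]
  congr 2
  simp
  ring

/-- Poisson summation for a modulated Fourier transform of a function supported in `(0,1)`. -/
theorem tsum_fourier_translate (f : 𝓢(ℝ, ℂ)) (hf : ∀ y ∉ Set.Ioo (0 : ℝ) 1, f y = 0) (x ξ : ℝ) :
    ∑' n : ℤ, 𝓕 (f.compSubConstCLM ℂ (-x)) (ξ + n)
      = f (Int.fract x) * fourier ⌊x⌋ (ξ : UnitAddCircle) := by
  rw [SchwartzMap.tsum_eq_tsum_fourier (𝓕 (f.compSubConstCLM ℂ (-x))) ξ]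
  -- Two Fourier transforms make a reflection, so the Poisson coefficients are samples of `f`; the
  -- support condition leaves only `n = ⌊x⌋`.
  have key : ∀ n : ℤ, 𝓕 (𝓕 (f.compSubConstCLM ℂ (-x))) (n : ℝ) = f (x - n) := by
    intro n
    have h1 : 𝓕⁻ (𝓕 (f.compSubConstCLM ℂ (-x))) (-(n : ℝ)) = f (x - n) := by
      rw [FourierTransform.fourierInv_fourier_eq, SchwartzMap.compSubConstCLM_apply]
      congr 1
      ring
    rw [← h1, SchwartzMap.fourierInv_coe, Real.fourierInv_eq_fourier_neg, neg_neg,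
      SchwartzMap.fourier_coe (𝓕 (f.compSubConstCLM ℂ (-x)))]
  rw [tsum_eq_single ⌊x⌋]
  · rw [key]; rfl
  · intro n hn
    rw [key, hf, zero_mul]
    rintro ⟨h0, h1⟩
    exact hn (Int.floor_eq_iff.2 ⟨by linarith, by linarith⟩).symm

/-- Absorb `e^{2πixξ}` into the transform of the translate `f(· + x)`, fold the integral over `ℝ`
onto one period using the periodicity of `M`, and apply Poisson summation: a single frequency `⌊x⌋`
survives. -/
theorem fourierInv_periodic_mul {M : UnitAddCircle → ℂ} (hM : MemLp M ∞ AddCircle.haarAddCircle)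
    (f : 𝓢(ℝ, ℂ)) (hf : ∀ y ∉ Set.Ioo (0 : ℝ) 1, f y = 0) (x : ℝ) :
    𝓕⁻ (fun ξ : ℝ => M ξ * 𝓕 (f : ℝ → ℂ) ξ) x
      = (∫ t, M t * fourier ⌊x⌋ t ∂AddCircle.haarAddCircle) * f (Int.fract x) := by
  set h : 𝓢(ℝ, ℂ) := 𝓕 (f.compSubConstCLM ℂ (-x)) with hh
  have hval : ∀ ξ : ℝ, Complex.exp (2 * Real.pi * Complex.I * x * ξ) * 𝓕 (f : ℝ → ℂ) ξ = h ξ := by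
    intro ξ
    rw [hh, SchwartzMap.fourier_coe]
    have := fourier_comp_sub f (-x) ξ
    simp only [Complex.ofReal_neg] at this
    rw [show ((f.compSubConstCLM ℂ (-x) : 𝓢(ℝ, ℂ)) : ℝ → ℂ) = fun y => f (y - -x) from rfl, this]
    congr 2
    ring
  have hint : Integrable (fun ξ : ℝ => M ξ * h ξ) := by
    exact (h.integrable (μ := volume)).mul_of_top_right (memLp_top_comp_coe hM)
  have hper : ∀ (n : ℤ) (ξ : ℝ), ((ξ + n : ℝ) : UnitAddCircle) = (ξ : UnitAddCircle) := by
    intro n ξ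
    rw [← AddCircle.coe_fract, Int.fract_add_intCast, AddCircle.coe_fract]
  have h1 := hint.hasSum_intervalIntegral_comp_add_int
  have hn := hint.norm.hasSum_intervalIntegral_comp_add_int.summable
  simp only [hper, intervalIntegral.integral_of_le zero_le_one] at h1 hn
  have h2 := hasSum_integral_of_summable_integral_norm
    (μ := volume.restrict (Set.Ioc (0 : ℝ) 1)) (F := fun (n : ℤ) (ξ : ℝ) => M ξ * h (ξ + n))
    (fun n => ?_) hn
  · rw [fourierInv_eq_integral]
    have e1 : ∀ ξ : ℝ, Complex.exp (2 * Real.pi * Complex.I * x * ξ) * (M ξ * 𝓕 (f : ℝ → ℂ) ξ)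
        = M ξ * h ξ := fun ξ => by rw [← hval]; ring
    simp_rw [e1]
    rw [h1.unique h2, integral_haar_eq, ← integral_mul_const]
    refine integral_congr_ae (ae_of_all _ fun ξ => ?_)
    simp only
    rw [tsum_mul_left, hh, tsum_fourier_translate f hf]
    ring
  · have := (hint.comp_add_right (n : ℝ)).restrict (s := Set.Ioc (0 : ℝ) 1)
    simpa only [hper] using this

/-- The `L^p(ℝ)` norm of a step-modulated periodic profile factors. -/
theorem eLpNorm_floor_fract {p : ℝ≥0∞} (hp0 : p ≠ 0) (hp : p ≠ ∞) (b : ℤ → ℂ) {f : ℝ → ℂ}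
    (hfm : Measurable f) (hf : ∀ y ∉ Set.Ioo (0 : ℝ) 1, f y = 0) :
    eLpNorm (fun x : ℝ => b ⌊x⌋ * f (Int.fract x)) p volume
      = eLpNorm b p Measure.count * eLpNorm f p volume := by
  have hr : 0 < p.toReal := ENNReal.toReal_pos hp0 hp
  simp only [eLpNorm_eq_lintegral_rpow_enorm_toReal hp0 hp]
  rw [← ENNReal.mul_rpow_of_nonneg _ _ (by positivity)]
  congr 1
  rw [lintegral_count, ← setLIntegral_univ, ← iUnion_Ico_intCast ℝ,
    lintegral_iUnion (fun _ => measurableSet_Ico) (Set.pairwise_disjoint_Ico_intCast ℝ),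
    ← ENNReal.tsum_mul_right]
  refine tsum_congr fun n => ?_
  have e : ∀ x ∈ Set.Ico (n : ℝ) (n + 1), ‖b ⌊x⌋ * f (Int.fract x)‖ₑ ^ p.toReal
      = ‖b n‖ₑ ^ p.toReal * ‖f (x - n)‖ₑ ^ p.toReal := by
    intro x hx
    have : ⌊x⌋ = n := Int.floor_eq_iff.2 hx
    rw [Int.fract, this, enorm_mul, ENNReal.mul_rpow_of_nonneg _ _ hr.le]
  rw [setLIntegral_congr_fun measurableSet_Ico e, lintegral_const_mul _ (by fun_prop),
    setLIntegral_eq_of_support_subset, lintegral_sub_right_eq_self (fun x => ‖f x‖ₑ ^ p.toReal)]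
  intro y hy
  have hy' : y - n ∈ Set.Ioo (0 : ℝ) 1 := by
    by_contra hc
    simp [hf _ hc, hr] at hy
  exact ⟨by linarith [hy'.1], by linarith [hy'.2]⟩

theorem continuous_seqFourier (a : ℤ →₀ ℂ) : Continuous (seqFourier a) := by
  unfold seqFourier Finsupp.sum
  fun_prop

/-- A nonzero Schwartz function supported in `(0,1)`. -/
theorem exists_schwartz_supported_Ioo :
    ∃ f : 𝓢(ℝ, ℂ), (∀ y ∉ Set.Ioo (0 : ℝ) 1, f y = 0) ∧ f (1 / 2) = 1 := by
  let g : ContDiffBump (1 / 2 : ℝ) := ⟨1 / 8, 1 / 4, by norm_num, by norm_num⟩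
  have hc : HasCompactSupport (fun x : ℝ => (g x : ℂ)) :=
    g.hasCompactSupport.comp_left Complex.ofReal_zero
  have hs : ContDiff ℝ ((⊤ : ℕ∞) : WithTop ℕ∞) (fun x : ℝ => (g x : ℂ)) :=
    Complex.ofRealCLM.contDiff.comp g.contDiff
  refine ⟨hc.toSchwartzMap hs, fun y hy => ?_, ?_⟩
  · change ((g y : ℝ) : ℂ) = 0
    rw [g.zero_of_le_dist, Complex.ofReal_zero]
    by_contra hlt
    rw [not_le, Real.dist_eq, abs_lt] at hlt
    have h1 : (-(1 / 4) : ℝ) < y - 1 / 2 := hlt.1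
    have h2 : y - 1 / 2 < (1 / 4 : ℝ) := hlt.2
    exact hy ⟨by linarith, by linarith⟩
  · change ((g (1 / 2) : ℝ) : ℂ) = 1
    rw [g.one_of_mem_closedBall (Metric.mem_closedBall_self g.rIn_pos.le), Complex.ofReal_one]

/-- The superposition `∑ a(k) f(· - k)` of integer translates. -/
def translateSum (a : ℤ →₀ ℂ) (f : 𝓢(ℝ, ℂ)) : 𝓢(ℝ, ℂ) :=
  a.sum fun k c => c • f.compSubConstCLM ℂ (k : ℝ)

theorem translateSum_apply (a : ℤ →₀ ℂ) (f : 𝓢(ℝ, ℂ)) (x : ℝ) :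
    translateSum a f x = a.sum fun k c => c * f (x - k) := by
  simp [translateSum, Finsupp.sum]

theorem translateSum_eq (a : ℤ →₀ ℂ) {f : 𝓢(ℝ, ℂ)} (hf : ∀ y ∉ Set.Ioo (0 : ℝ) 1, f y = 0) :
    (translateSum a f : ℝ → ℂ) = fun x => a ⌊x⌋ * f (Int.fract x) := by
  funext x
  rw [translateSum_apply, Finsupp.sum, Finset.sum_eq_single ⌊x⌋]
  · rfl
  · intro n _ hn
    rw [hf, mul_zero]
    rintro ⟨h0, h1⟩
    exact hn (Int.floor_eq_iff.2 ⟨by linarith, by linarith⟩).symm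
  · intro h
    rw [Finsupp.notMem_support_iff.1 h, zero_mul]

theorem fourier_translateSum (a : ℤ →₀ ℂ) (f : 𝓢(ℝ, ℂ)) (ξ : ℝ) :
    𝓕 (translateSum a f : ℝ → ℂ) ξ = seqFourier a (ξ : UnitAddCircle) * 𝓕 (f : ℝ → ℂ) ξ := by
  have h1 : 𝓕 (translateSum a f) = a.sum fun k c => c • 𝓕 (f.compSubConstCLM ℂ (k : ℝ)) := by
    simp only [translateSum, Finsupp.sum, ← FourierTransform.fourierCLM_apply (R := ℂ), map_sum,
      map_smul]
  rw [← SchwartzMap.fourier_coe, h1, seqFourier, Finsupp.sum, Finsupp.sum, sum_apply,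
    Finset.sum_mul]
  refine Finset.sum_congr rfl fun k _ => ?_
  rw [smul_apply, SchwartzMap.fourier_coe,
    show ((f.compSubConstCLM ℂ (k : ℝ) : 𝓢(ℝ, ℂ)) : ℝ → ℂ) = fun y => f (y - k) from rfl,
    fourier_comp_sub, fourier_coe_apply, smul_eq_mul, ← mul_assoc]
  congr 3
  push_cast
  ring

/-- A bounded function on the circle whose periodic extension is an `L^p(ℝ)` multiplier is an
`ℓ^p(ℤ)` multiplier with the same bound. -/
theorem circleMultiplierBound_of_comp_coe {p : ℝ≥0∞} (hp0 : p ≠ 0) (hp : p ≠ ∞)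
    {m : UnitAddCircle → ℂ} (hm : MemLp m ∞ AddCircle.haarAddCircle) {C : ℝ≥0}
    (h : RealMultiplierBound p (fun ξ : ℝ => m ξ) C) : CircleMultiplierBound p m C := by
  intro a
  obtain ⟨f, hf, hf1⟩ := exists_schwartz_supported_Ioo
  have hM : MemLp (fun t => m t * seqFourier a t) ∞ AddCircle.haarAddCircle := by
    have hs : MemLp (seqFourier a) ∞ AddCircle.haarAddCircle := by
      obtain ⟨B, hB⟩ := isCompact_univ.exists_bound_of_continuousOn
        (continuous_seqFourier a).continuousOn
      exact memLp_top_of_bound (continuous_seqFourier a).aestronglyMeasurable B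
        (ae_of_all _ fun t => hB t (Set.mem_univ t))
    exact hs.mul hm
  have hop : 𝓕⁻ (fun ξ : ℝ => m ξ * 𝓕 (translateSum a f : ℝ → ℂ) ξ)
      = fun x : ℝ => seqMultiplierOp m a ⌊x⌋ * f (Int.fract x) := by
    funext x
    simp_rw [fourier_translateSum, ← mul_assoc]
    exact fourierInv_periodic_mul hM f hf x
  have key := h (translateSum a f)
  rw [hop, translateSum_eq a hf, eLpNorm_floor_fract hp0 hp _ f.continuous.measurable hf,
    eLpNorm_floor_fract hp0 hp _ f.continuous.measurable hf, ← mul_assoc] at key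
  -- Both sides now carry the factor `‖f‖_p`, which is finite and nonzero and so cancels.
  have hfp : eLpNorm (f : ℝ → ℂ) p volume ≠ ∞ := (f.memLp p volume).eLpNorm_ne_top
  have hf0 : eLpNorm (f : ℝ → ℂ) p volume ≠ 0 := by
    rw [Ne, eLpNorm_eq_zero_iff f.continuous.aestronglyMeasurable hp0,
      Continuous.ae_eq_iff_eq volume f.continuous continuous_zero]
    intro h0
    rw [h0] at hf1
    exact zero_ne_one hf1
  exact (ENNReal.mul_le_mul_iff_left hf0 hfp).1 key

/-! ### Elementary properties of real multipliers -/

theorem RealMultiplierBound.congr_ae {p : ℝ≥0∞} {m m' : ℝ → ℂ} {C : ℝ≥0}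
    (h : RealMultiplierBound p m C) (hm : m =ᵐ[volume] m') : RealMultiplierBound p m' C := by
  intro f
  have : 𝓕⁻ (fun ξ : ℝ => m' ξ * 𝓕 (f : ℝ → ℂ) ξ) = 𝓕⁻ (fun ξ : ℝ => m ξ * 𝓕 (f : ℝ → ℂ) ξ) := by
    funext x
    rw [fourierInv_eq_integral, fourierInv_eq_integral]
    refine integral_congr_ae ?_
    filter_upwards [hm] with ξ hξ
    rw [hξ]
  rw [this]
  exact h f

/-- The modulation composes the operator with a translation by `x`, an isometry of `L^p(ℝ)`. -/
theorem RealMultiplierBound.modulate {p : ℝ≥0∞} {m : ℝ → ℂ} {C : ℝ≥0}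
    (h : RealMultiplierBound p m C) (x : ℝ) : RealMultiplierBound p (modulate x m) C := by
  intro f
  have e : 𝓕⁻ (fun ξ : ℝ => SummabilityKernels.modulate x m ξ * 𝓕 (f : ℝ → ℂ) ξ)
      = 𝓕⁻ (fun ξ : ℝ => m ξ * 𝓕 (f : ℝ → ℂ) ξ) ∘ fun y => y + x := by
    funext y
    rw [Function.comp_apply, ← fourierInv_modulate]
    simp only [SummabilityKernels.modulate, mul_assoc]
  rw [e, ← (measurableEmbedding_addRight x).eLpNorm_map_measure, map_add_right_eq_self]
  exact h f

theorem RealMultiplierBound.mono {p : ℝ≥0∞} {m : ℝ → ℂ} {C D : ℝ≥0}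
    (h : RealMultiplierBound p m C) (hCD : C ≤ D) : RealMultiplierBound p m D :=
  fun f => (h f).trans (by gcongr)

/-- The infimum defining the multiplier norm is attained. -/
theorem realMultiplierBound_norm {p : ℝ≥0∞} [Fact (1 ≤ p)] {m : ℝ → ℂ}
    (h : m ∈ RealMultiplier p) : RealMultiplierBound p m (realMultiplierNorm p m) := by
  intro f
  have hf : eLpNorm (f : ℝ → ℂ) p volume ≠ ∞ := (f.memLp p volume).eLpNorm_ne_top
  have hlim : Tendsto (fun C : ℝ≥0 => (C : ℝ≥0∞) * eLpNorm (f : ℝ → ℂ) p volume)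
      (𝓝[>] (realMultiplierNorm p m))
      (𝓝 ((realMultiplierNorm p m : ℝ≥0∞) * eLpNorm (f : ℝ → ℂ) p volume)) :=
    (ENNReal.Tendsto.mul_const (ENNReal.tendsto_coe.2 tendsto_id) (Or.inr hf)).mono_left
      nhdsWithin_le_nhds
  -- Every `C` strictly above the infimum is a bound; let `C` decrease to it.
  refine ge_of_tendsto hlim ?_
  filter_upwards [self_mem_nhdsWithin] with C hC
  obtain ⟨D, hD, hDC⟩ := exists_lt_of_csInf_lt h.2 hC
  exact RealMultiplierBound.mono hD hDC.le f

/-! ### Two families of multipliers on the integers -/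

theorem fourier_apply_add (n : ℤ) (s t : UnitAddCircle) :
    fourier n (s + t) = fourier n s * fourier n t := by
  simp only [fourier_apply, smul_add, AddCircle.toCircle_add, Circle.coe_mul]

theorem integral_fourier_eq_zero {n : ℤ} (hn : n ≠ 0) :
    ∫ t : UnitAddCircle, fourier n t ∂AddCircle.haarAddCircle = 0 :=
  integral_eq_zero_of_add_right_eq_neg (fourier_add_half_inv_index hn one_pos)

/-- The character `n ↦ e^{2πi n y}` of the integers. -/
def intChar (y : ℝ) (n : ℤ) : ℂ := fourier n (y : UnitAddCircle)

/-- The operator is translation by `y` on the circle. -/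
theorem intMultiplierBound_intChar (p : ℝ≥0∞) (y : ℝ) : IntMultiplierBound p (intChar y) 1 := by
  intro f hf
  have hmp : MeasurePreserving (fun t : UnitAddCircle => t + (y : UnitAddCircle))
      AddCircle.haarAddCircle AddCircle.haarAddCircle := measurePreserving_add_right _ _
  refine ⟨f ∘ fun t => t + (y : UnitAddCircle), hf.comp_measurePreserving hmp, fun n => ?_, ?_⟩
  · rw [fourierCoeff, fourierCoeff,
      ← integral_add_right_eq_self (fun t => fourier (-n) t • f t) (y : UnitAddCircle),
      intChar, ← integral_const_mul]
    refine integral_congr_ae (ae_of_all _ fun t => ?_)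
    simp only [Function.comp_apply, smul_eq_mul, fourier_apply_add, ← mul_assoc]
    rw [mul_comm (fourier n (y : UnitAddCircle)), mul_assoc (fourier (-n) t), ← fourier_add,
      add_neg_cancel, fourier_zero, mul_one]
  · rw [eLpNorm_comp_measurePreserving hf.1 hmp, ENNReal.coe_one, one_mul]

theorem intMultiplierNorm_intChar_le (p : ℝ≥0∞) (y : ℝ) : intMultiplierNorm p (intChar y) ≤ 1 :=
  csInf_le (OrderBot.bddBelow _) (intMultiplierBound_intChar p y)

/-- The operator replaces `f` by its mean, a contraction on a probability space. Since the
associated kernel series is `Λ` itself, this yields `Λ ∈ L^∞`. -/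
theorem intMultiplierBound_single {p : ℝ≥0∞} (hp : 1 ≤ p) :
    IntMultiplierBound p (Pi.single 0 1) 1 := by
  intro f hf
  refine ⟨fun _ => fourierCoeff f 0, memLp_const _, fun n => ?_, ?_⟩
  · rw [fourierCoeff]
    simp_rw [smul_eq_mul]
    rw [integral_mul_const]
    rcases eq_or_ne n 0 with rfl | hn
    · simp
    · rw [integral_fourier_eq_zero (neg_ne_zero.2 hn)]
      simp [hn]
  · rw [ENNReal.coe_one, one_mul, eLpNorm_const _ (by positivity) (NeZero.ne _)]
    have : ‖fourierCoeff f 0‖ₑ ≤ eLpNorm f 1 AddCircle.haarAddCircle := by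
      rw [fourierCoeff, eLpNorm_one_eq_lintegral_enorm]
      refine (enorm_integral_le_lintegral_enorm _).trans (le_of_eq ?_)
      simp
    simpa using this.trans (eLpNorm_le_eLpNorm_of_exponent_le hp hf.1)

theorem kernelSeries_single (Λ : ℝ → ℂ) : kernelSeries (Pi.single 0 1) Λ = Λ := by
  funext ξ
  have : ∀ N : ℕ, kernelPartialSum (Pi.single 0 1) Λ N ξ = Λ ξ := by
    intro N
    rw [kernelPartialSum, Finset.sum_eq_single 0]
    · simp
    · intro n _ hn
      simp [hn]
    · simp
  simp only [kernelSeries, this]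
  exact tendsto_const_nhds.limUnder_eq

theorem SummabilityKernel.memLp_top {p : ℝ≥0∞} (hp : 1 ≤ p) {Λ : ℝ → ℂ}
    (h : Λ ∈ SummabilityKernel p) : MemLp Λ ∞ volume := by
  have := (h.2.1 _ ⟨1, intMultiplierBound_single hp⟩).2.1
  rwa [kernelSeries_single] at this

theorem intChar_neg (x : ℝ) (n : ℤ) : intChar (-x) n = fourier (-n) (x : UnitAddCircle) := by
  rw [intChar, fourier_coe_apply, fourier_coe_apply]
  push_cast
  congr 1
  ring

/-! ### Periodization in terms of kernel series -/

theorem sum_Icc_neg_succ (u : ℤ → ℂ) (N : ℕ) :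
    ∑ n ∈ Finset.Icc (-((N + 1 : ℕ) : ℤ)) ((N + 1 : ℕ) : ℤ), u n
      = ∑ n ∈ Finset.Icc (-(N : ℤ)) N, u n + u ((N + 1 : ℕ) : ℤ) + u (-((N + 1 : ℕ) : ℤ)) := by
  have h : Finset.Icc (-((N + 1 : ℕ) : ℤ)) ((N + 1 : ℕ) : ℤ)
      = insert (-((N + 1 : ℕ) : ℤ)) (insert ((N + 1 : ℕ) : ℤ) (Finset.Icc (-(N : ℤ)) N)) := by
    ext n
    simp only [Finset.mem_insert, Finset.mem_Icc]
    omega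
  rw [h, Finset.sum_insert, Finset.sum_insert]
  · ring
  · simp
  · simp only [Finset.mem_insert, Finset.mem_Icc]
    omega

theorem periodizationPartialSum_modulate (x : ℝ) (Λ : ℝ → ℂ) (N : ℕ) (ξ : ℝ) :
    periodizationPartialSum (modulate x Λ) N ξ
      = Complex.exp (2 * Real.pi * Complex.I * x * ξ) * kernelPartialSum (intChar (-x)) Λ N ξ := by
  rw [periodizationPartialSum, kernelPartialSum, Finset.mul_sum]
  refine Finset.sum_nbij' (fun n => -n) (fun n => -n) ?_ ?_ ?_ ?_ ?_
  · intro n hn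
    simp only [Finset.mem_Icc] at hn ⊢
    omega
  · intro n hn
    simp only [Finset.mem_Icc] at hn ⊢
    omega
  · simp
  · simp
  · intro n _
    rw [modulate, intChar, fourier_coe_apply, ← mul_assoc, ← Complex.exp_add]
    congr 2
    · push_cast
      ring
    · push_cast
      ring

theorem SummabilityKernel.tendsto_periodizationPartialSum {p : ℝ≥0∞} {Λ : ℝ → ℂ}
    (h : Λ ∈ SummabilityKernel p) (x : ℝ) :
    ∀ᵐ ξ : ℝ, Tendsto (fun N : ℕ => periodizationPartialSum (modulate x Λ) N ξ) atTop
      (𝓝 (modulate x (kernelSeries (intChar (-x)) Λ) ξ)) := by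
  filter_upwards [(h.2.1 _ ⟨1, intMultiplierBound_intChar p (-x)⟩).1] with ξ hξ
  simp_rw [periodizationPartialSum_modulate]
  exact (tendsto_nhds_limUnder hξ).const_mul _

theorem SummabilityKernel.exists_realMultiplierBound {p : ℝ≥0∞} [Fact (1 ≤ p)] {Λ : ℝ → ℂ}
    (h : Λ ∈ SummabilityKernel p) : ∃ C : ℝ≥0, ∀ x : ℝ,
      RealMultiplierBound p (modulate x (kernelSeries (intChar (-x)) Λ)) C := by
  obtain ⟨C, hC⟩ := h.2.2
  refine ⟨C, fun x => RealMultiplierBound.modulate ?_ x⟩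
  have hφ : intChar (-x) ∈ IntMultiplier p := ⟨1, intMultiplierBound_intChar p (-x)⟩
  refine (realMultiplierBound_norm (h.2.1 _ hφ).2).mono ((hC _ hφ).trans ?_)
  exact mul_le_of_le_one_right' (intMultiplierNorm_intChar_le p _)

/-! ### Decay of the translates of a summability kernel -/

theorem ae_forall_int_translate {Q : ℝ → Prop} (h : ∀ᵐ ξ : ℝ, Q ξ) :
    ∀ᵐ ξ : ℝ, ∀ n : ℤ, Q (ξ + n) :=
  ae_all_iff.2 fun n => (measurePreserving_add_right volume (n : ℝ)).quasiMeasurePreserving.ae h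

/-- The `L²` norm over a period of a trigonometric binomial. -/
theorem integral_normSq_binomial (a b : ℂ) {N : ℤ} (hN : N ≠ 0) :
    ∫ t : UnitAddCircle, ‖fourier N t * a + fourier (-N) t * b‖ ^ 2 ∂AddCircle.haarAddCircle
      = ‖a‖ ^ 2 + ‖b‖ ^ 2 := by
  have e : ∀ t : UnitAddCircle, ‖fourier N t * a + fourier (-N) t * b‖ ^ 2
      = (‖a‖ ^ 2 + ‖b‖ ^ 2)
        + 2 * (fourier (N + N) t * (a * (starRingEnd ℂ) b)).re := by
    intro t
    have h1 : ‖fourier N t‖ = 1 := by rw [fourier_apply, Circle.norm_coe]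
    have h2 : ‖fourier (-N) t‖ = 1 := by rw [fourier_apply, Circle.norm_coe]
    have h3 : (starRingEnd ℂ) (fourier (-N) t) = fourier N t := by
      rw [← fourier_neg, neg_neg]
    rw [← Complex.normSq_eq_norm_sq, Complex.normSq_add, map_mul (starRingEnd ℂ), h3,
      Complex.normSq_eq_norm_sq, Complex.normSq_eq_norm_sq, norm_mul, norm_mul, h1, h2,
      fourier_add, one_mul, one_mul]
    congr 3
    ring
  have hi : Integrable (fun t : UnitAddCircle => fourier (N + N) t * (a * (starRingEnd ℂ) b))
      AddCircle.haarAddCircle :=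
    (Continuous.integrable_of_hasCompactSupport (by fun_prop) (HasCompactSupport.of_compactSpace _))
  simp_rw [e]
  -- The cross term has frequency `2N ≠ 0`, hence mean zero.
  have hz : ∫ t : UnitAddCircle, (fourier (N + N) t * (a * (starRingEnd ℂ) b)).re
      ∂AddCircle.haarAddCircle = 0 := by
    have := integral_re hi
    simp only [RCLike.re_eq_complex_re] at this
    rw [this, integral_mul_const, integral_fourier_eq_zero (by omega), zero_mul, Complex.zero_re]
  have hr : Integrable (fun t : UnitAddCircle => (fourier (N + N) t * (a * (starRingEnd ℂ) b)).re)
      AddCircle.haarAddCircle := hi.re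
  rw [integral_add (integrable_const _) (hr.const_mul 2), integral_const_mul, hz,
    integral_const, probReal_univ, one_smul, mul_zero, add_zero]

/-- If symmetric binomials with bounded coefficients tend to zero at almost every point then so do
their coefficients. -/
theorem tendsto_coeff_zero_of_binomial {a b : ℕ → ℂ} {B : ℝ} (ha : ∀ N, ‖a N‖ ≤ B)
    (hb : ∀ N, ‖b N‖ ≤ B)
    (h : ∀ᵐ x : ℝ, Tendsto (fun N : ℕ => fourier (N : ℤ) (x : UnitAddCircle) * a N
      + fourier (-(N : ℤ)) (x : UnitAddCircle) * b N) atTop (𝓝 0)) :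
    Tendsto a atTop (𝓝 0) ∧ Tendsto b atTop (𝓝 0) := by
  have hc := ae_circle_of_ae_real (P := fun t => Tendsto (fun N : ℕ => fourier (N : ℤ) t * a N
      + fourier (-(N : ℤ)) t * b N) atTop (𝓝 0)) h
  have hlim := tendsto_integral_of_dominated_convergence
    (F := fun (N : ℕ) (t : UnitAddCircle) =>
      ‖fourier (N : ℤ) t * a N + fourier (-(N : ℤ)) t * b N‖ ^ 2) (f := fun _ => 0)
    (μ := AddCircle.haarAddCircle)
    (fun _ => (B + B) ^ 2) (fun N => by fun_prop) (integrable_const _) ?_ ?_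
  · rw [integral_zero] at hlim
    have hlim' : Tendsto (fun N => ‖a N‖ ^ 2 + ‖b N‖ ^ 2) atTop (𝓝 0) := by
      refine hlim.congr' ?_
      filter_upwards [eventually_ge_atTop 1] with N hN
      exact integral_normSq_binomial _ _ (by omega)
    have aux : ∀ {c : ℕ → ℂ}, (∀ N, ‖c N‖ ^ 2 ≤ ‖a N‖ ^ 2 + ‖b N‖ ^ 2) → Tendsto c atTop (𝓝 0) := by
      intro c hcN
      rw [tendsto_zero_iff_norm_tendsto_zero]
      have h2 := (squeeze_zero (fun N => sq_nonneg ‖c N‖) hcN hlim').sqrt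
      simpa using h2
    exact ⟨aux fun N => le_add_of_nonneg_right (sq_nonneg _),
      aux fun N => le_add_of_nonneg_left (sq_nonneg _)⟩
  · intro N
    refine ae_of_all _ fun t => ?_
    rw [Real.norm_of_nonneg (sq_nonneg _)]
    gcongr
    refine (norm_add_le _ _).trans (add_le_add ?_ ?_)
    · rw [norm_mul, fourier_apply, Circle.norm_coe, one_mul]; exact ha N
    · rw [norm_mul, fourier_apply, Circle.norm_coe, one_mul]; exact hb N
  · filter_upwards [hc] with t ht
    simpa using (ht.norm.pow 2)

/-- Convergence of the symmetric series for the character with parameter `-x` forces its increments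
`e^{2πixN} Λ(ξ + N) + e^{-2πixN} Λ(ξ - N)` to tend to 0. This holds for every `x`, so averaging the
squared modulus over `x` separates the two coefficients. -/
theorem SummabilityKernel.tendsto_translate_zero {p : ℝ≥0∞} (hp : 1 ≤ p) {Λ : ℝ → ℂ}
    (h : Λ ∈ SummabilityKernel p) :
    ∀ᵐ ξ : ℝ, Tendsto (fun N : ℕ => Λ (ξ + N)) atTop (𝓝 0) ∧
      Tendsto (fun N : ℕ => Λ (ξ - N)) atTop (𝓝 0) := by
  obtain ⟨Λ', hΛ', hae⟩ := h.1
  obtain ⟨B, hB⟩ := exists_ae_norm_le_of_eLpNorm_top (SummabilityKernel.memLp_top hp h).2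
  have hae' := ae_forall_int_translate hae
  have hx : ∀ x : ℝ, ∀ᵐ ξ : ℝ, Tendsto (fun N : ℕ =>
      fourier (N : ℤ) (x : UnitAddCircle) * Λ' (ξ + N)
      + fourier (-(N : ℤ)) (x : UnitAddCircle) * Λ' (ξ - N)) atTop (𝓝 0) := by
    intro x
    filter_upwards [hae', (h.2.1 _ ⟨1, intMultiplierBound_intChar p (-x)⟩).1] with ξ h1 ⟨w, hw⟩
    rw [← tendsto_add_atTop_iff_nat 1]
    have hd := (hw.comp (tendsto_add_atTop_nat 1)).sub hw
    rw [sub_self] at hd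
    refine hd.congr fun N => ?_
    have e1 := h1 ((N + 1 : ℕ) : ℤ)
    have e2 := h1 (-((N + 1 : ℕ) : ℤ))
    simp only [Int.cast_neg, Int.cast_natCast, ← sub_eq_add_neg] at e1 e2
    rw [Function.comp_apply, kernelPartialSum, sum_Icc_neg_succ, ← kernelPartialSum, ← e1, ← e2,
      intChar_neg, intChar_neg, neg_neg]
    push_cast
    rw [sub_neg_eq_add]
    ring
  -- The null set of bad `ξ` depends on `x`; Fubini exchanges the quantifiers. This requires a
  -- jointly measurable set, hence the measurable representative `Λ'`.
  have hmeas : MeasurableSet {q : ℝ × ℝ | Tendsto (fun N : ℕ =>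
      fourier (N : ℤ) (q.1 : UnitAddCircle) * Λ' (q.2 + N)
      + fourier (-(N : ℤ)) (q.1 : UnitAddCircle) * Λ' (q.2 - N)) atTop (𝓝 0)} := by
    have hm := hΛ'.measurable
    refine measurableSet_tendsto _ fun N => ?_
    have hc : ∀ n : ℤ, Measurable fun q : ℝ × ℝ => fourier n (q.1 : UnitAddCircle) := fun n =>
      (fourier n).continuous.measurable.comp (AddCircle.measurable_mk'.comp measurable_fst)
    exact ((hc _).mul (hm.comp (measurable_snd.add_const _))).add
      ((hc _).mul (hm.comp (measurable_snd.sub_const _)))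
  have hcomm := (Measure.ae_ae_comm (μ := volume) (ν := volume) hmeas).1 (ae_of_all _ hx)
  filter_upwards [hcomm, hae', ae_forall_int_translate hB] with ξ h1 h2 h3
  have e1 : ∀ N : ℕ, Λ' (ξ + N) = Λ (ξ + N) := fun N => by simpa using (h2 N).symm
  have e2 : ∀ N : ℕ, Λ' (ξ - N) = Λ (ξ - N) := fun N => by
    simpa [sub_eq_add_neg] using (h2 (-N)).symm
  simp only [e1, e2] at h1
  exact tendsto_coeff_zero_of_binomial (fun N => by simpa using h3 N)
    (fun N => by simpa [sub_eq_add_neg] using h3 (-N)) h1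

/-! ### Existence of the periodizations -/

theorem periodizationPartialSum_succ (g : ℝ → ℂ) (N : ℕ) (ξ : ℝ) :
    periodizationPartialSum g (N + 1) ξ
      = periodizationPartialSum g N ξ + g (ξ + (N + 1)) + g (ξ - (N + 1)) := by
  rw [periodizationPartialSum, sum_Icc_neg_succ, ← periodizationPartialSum]
  push_cast
  rw [← sub_eq_add_neg]

/-- Shifting the window of summation by one gains one boundary term and loses another. -/
theorem periodizationPartialSum_add_one (g : ℝ → ℂ) (N : ℕ) (ξ : ℝ) :
    periodizationPartialSum g N (ξ + 1) + g (ξ - N)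
      = periodizationPartialSum g N ξ + g (ξ + N + 1) := by
  induction N with
  | zero => simp [periodizationPartialSum, add_comm]
  | succ N ih =>
    rw [periodizationPartialSum_succ, periodizationPartialSum_succ]
    push_cast
    rw [show ξ + 1 - ((N : ℝ) + 1) = ξ - N by ring,
      show ξ + 1 + ((N : ℝ) + 1) = ξ + (N + 1) + 1 by ring,
      show ξ + ((N : ℝ) + 1) = ξ + N + 1 by ring] at *
    linear_combination ih

/-- If the symmetric partial sums converge a.e. and the translates tend to zero a.e., then the
periodization exists. -/
theorem hasPeriodization_of_tendsto {g F : ℝ → ℂ}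
    (h : ∀ᵐ ξ : ℝ, Tendsto (fun N : ℕ => periodizationPartialSum g N ξ) atTop (𝓝 (F ξ)))
    (hd : ∀ᵐ ξ : ℝ, Tendsto (fun N : ℕ => g (ξ + N)) atTop (𝓝 0) ∧
      Tendsto (fun N : ℕ => g (ξ - N)) atTop (𝓝 0)) :
    ∀ᵐ ξ : ℝ, Tendsto (fun N : ℕ => periodizationPartialSum g N ξ) atTop (𝓝 (F ξ)) ∧
      periodization g (ξ : UnitAddCircle) = F ξ := by
  filter_upwards [ae_forall_int_translate h, ae_forall_int_translate hd] with ξ h1 h2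
  have h0 := h1 0
  rw [Int.cast_zero, add_zero] at h0
  refine ⟨h0, ?_⟩
  have step : ∀ n : ℤ, F (ξ + (n + 1 : ℤ)) = F (ξ + n) := by
    intro n
    have t1 := h1 (n + 1)
    have t2 := (((h1 n).add ((h2 n).1.comp (tendsto_add_atTop_nat 1))).sub (h2 n).2)
    rw [add_zero, sub_zero] at t2
    refine tendsto_nhds_unique (t1.congr fun N => ?_) t2
    have := periodizationPartialSum_add_one g N (ξ + n)
    simp only [Function.comp_apply]
    push_cast
    rw [← add_assoc ξ, ← add_assoc (ξ + n)]
    linear_combination this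
  have hall : ∀ n : ℤ, F (ξ + n) = F ξ := by
    intro n
    induction n using Int.induction_on with
    | zero => simp
    | succ k ih => rw [step, ih]
    | pred k ih => rw [← ih, ← step, sub_add_cancel]
  -- `periodization` evaluates the limit at the fractional part, so agreement with `F ξ` needs the
  -- invariance of `F` under integer shifts.
  have hfr : Int.fract ξ = ξ + ((-⌊ξ⌋ : ℤ) : ℝ) := by
    rw [Int.fract, sub_eq_add_neg, Int.cast_neg]
  rw [periodization, liftIco_eq_circleRep, circleRep_coe, hfr, (h1 (-⌊ξ⌋)).limUnder_eq, hall]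

theorem norm_modulate (x : ℝ) (g : ℝ → ℂ) (ξ : ℝ) : ‖modulate x g ξ‖ = ‖g ξ‖ := by
  rw [modulate, norm_mul, show (2 * Real.pi * Complex.I * x * ξ : ℂ)
    = ((2 * Real.pi * x * ξ : ℝ) : ℂ) * Complex.I by push_cast; ring,
    Complex.norm_exp_ofReal_mul_I, one_mul]

theorem memLp_modulate {g : ℝ → ℂ} (hg : MemLp g ∞ volume) (x : ℝ) :
    MemLp (modulate x g) ∞ volume := by
  have hc : Continuous fun ξ : ℝ => Complex.exp (2 * Real.pi * Complex.I * x * ξ) := by fun_prop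
  refine hg.of_le (hc.aestronglyMeasurable.mul hg.1) (ae_of_all _ fun ξ => le_of_eq ?_)
  exact norm_modulate x g ξ

theorem SummabilityKernel.periodization_spec {p : ℝ≥0∞} (hp : 1 ≤ p) {Λ : ℝ → ℂ}
    (h : Λ ∈ SummabilityKernel p) (x : ℝ) :
    ∀ᵐ ξ : ℝ, Tendsto (fun N : ℕ => periodizationPartialSum (modulate x Λ) N ξ) atTop
        (𝓝 (modulate x (kernelSeries (intChar (-x)) Λ) ξ)) ∧
      periodization (modulate x Λ) (ξ : UnitAddCircle)
        = modulate x (kernelSeries (intChar (-x)) Λ) ξ := by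
  refine hasPeriodization_of_tendsto (SummabilityKernel.tendsto_periodizationPartialSum h x) ?_
  filter_upwards [SummabilityKernel.tendsto_translate_zero hp h] with ξ hξ
  refine ⟨tendsto_zero_iff_norm_tendsto_zero.2 ?_, tendsto_zero_iff_norm_tendsto_zero.2 ?_⟩
  · simpa only [norm_modulate] using tendsto_zero_iff_norm_tendsto_zero.1 hξ.1
  · simpa only [norm_modulate] using tendsto_zero_iff_norm_tendsto_zero.1 hξ.2

theorem SummabilityKernel.hasPeriodization {p : ℝ≥0∞} (hp : 1 ≤ p) {Λ : ℝ → ℂ}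
    (h : Λ ∈ SummabilityKernel p) (x : ℝ) : HasPeriodization (modulate x Λ) := by
  filter_upwards [SummabilityKernel.periodization_spec hp h x] with ξ hξ
  rw [hξ.2]
  exact hξ.1

theorem SummabilityKernel.memLp_periodization {p : ℝ≥0∞} (hp : 1 ≤ p) {Λ : ℝ → ℂ}
    (h : Λ ∈ SummabilityKernel p) (x : ℝ) :
    MemLp (periodization (modulate x Λ)) ∞ AddCircle.haarAddCircle := by
  have h1 : MemLp (fun ξ : ℝ => periodization (modulate x Λ) (ξ : UnitAddCircle)) ∞ volume := by
    refine (memLp_congr_ae ?_).1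
      (memLp_modulate (h.2.1 _ ⟨1, intMultiplierBound_intChar p (-x)⟩).2.1 x)
    filter_upwards [SummabilityKernel.periodization_spec hp h x] with ξ hξ
    exact hξ.2.symm
  have h2 := (h1.restrict (Set.Ioc (0 : ℝ) 1)).comp_measurePreserving measurePreserving_circleRep
  simpa only [Function.comp_def, coe_circleRep] using h2

theorem SummabilityKernel.exists_circleMultiplierBound {p : ℝ≥0∞} (hp : 1 ≤ p) (hp' : p ≠ ∞)
    {Λ : ℝ → ℂ} (h : Λ ∈ SummabilityKernel p) : ∃ C : ℝ≥0, ∀ x : ℝ,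
      CircleMultiplierBound p (periodization (modulate x Λ)) C := by
  have : Fact (1 ≤ p) := ⟨hp⟩
  obtain ⟨C, hC⟩ := SummabilityKernel.exists_realMultiplierBound h
  refine ⟨C, fun x => circleMultiplierBound_of_comp_coe (zero_lt_one.trans_le hp).ne' hp'
    (SummabilityKernel.memLp_periodization hp h x) ((hC x).congr_ae ?_)⟩
  filter_upwards [SummabilityKernel.periodization_spec hp h x] with ξ hξ
  exact hξ.2.symm

/-! ### Measurability of the multiplier norm -/

/-- Convolution of a sequence with a finitely supported one. -/
def seqConv (c : ℤ → ℂ) (a : ℤ →₀ ℂ) (n : ℤ) : ℂ :=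
  a.sum fun k z => z * c (n - k)

/-- `C` bounds on `ℓ^p(ℤ)` the operator of convolution with `c`. -/
def ConvolutionBound (p : ℝ≥0∞) (c : ℤ → ℂ) (C : ℝ≥0) : Prop :=
  ∀ a : ℤ →₀ ℂ, eLpNorm (seqConv c a) p Measure.count
    ≤ (C : ℝ≥0∞) * eLpNorm (a : ℤ → ℂ) p Measure.count

/-- The norm on `ℓ^p(ℤ)` of the operator of convolution with `c`. -/
def convolutionNorm (p : ℝ≥0∞) (c : ℤ → ℂ) : ℝ≥0 :=
  sInf {C | ConvolutionBound p c C}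

/-- Closedness is for pointwise convergence of `c`: each value of the convolution is a finite sum,
so it passes to the limit, and Fatou's lemma preserves the bound. -/
theorem isClosed_convolutionBound (p : ℝ≥0∞) (C : ℝ≥0) :
    IsClosed {c : ℤ → ℂ | ConvolutionBound p c C} := by
  refine IsSeqClosed.isClosed fun u c hu hc a => ?_
  have hlim : ∀ n, Tendsto (fun j => seqConv (u j) a n) atTop (𝓝 (seqConv c a n)) := by
    intro n
    refine tendsto_finsetSum _ fun k _ => ?_
    exact ((tendsto_pi_nhds.1 hc) (n - k)).const_mul _
  refine (Lp.eLpNorm_lim_le_liminf_eLpNorm (fun _ => Measurable.of_discrete.aestronglyMeasurable)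
    (seqConv c a) (ae_of_all _ hlim)).trans ?_
  refine liminf_le_of_le (by isBoundedDefault) fun b hb => ?_
  obtain ⟨j, hj⟩ := hb.exists
  exact hj.trans (hu j a)

theorem measurable_convolutionNorm (p : ℝ≥0∞) : Measurable (convolutionNorm p) := by
  have mono : ∀ {c : ℤ → ℂ} {C D : ℝ≥0}, ConvolutionBound p c C → C ≤ D →
      ConvolutionBound p c D := fun h hCD a => (h a).trans (by gcongr)
  refine measurable_of_Iio fun r => ?_
  have : convolutionNorm p ⁻¹' Set.Iio r
      -- Rational bounds make the union countable. The second piece collects the `c` with no bound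
      -- at all, whose norm is `sInf ∅ = 0`.
      = (⋃ q : {q : ℚ // (q : ℝ).toNNReal < r}, {c | ConvolutionBound p c (q.1 : ℝ).toNNReal}) ∪
        ((⋃ n : ℕ, {c | ConvolutionBound p c n})ᶜ ∩ {_c | 0 < r}) := by
    ext c
    simp only [Set.mem_preimage, Set.mem_Iio, Set.mem_union, Set.mem_iUnion, Set.mem_ofPred_eq,
      Set.mem_inter_iff, Set.mem_compl_iff, not_exists]
    constructor
    · intro hc
      by_cases hne : ∃ C, ConvolutionBound p c C
      · obtain ⟨D, hD, hDr⟩ := exists_lt_of_csInf_lt hne hc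
        obtain ⟨q, hq1, hq2⟩ := exists_rat_btwn (NNReal.coe_lt_coe.2 hDr)
        have hq0 : (0 : ℝ) ≤ q := D.2.trans hq1.le
        exact Or.inl ⟨⟨q, (Real.toNNReal_lt_iff_lt_coe hq0).2 hq2⟩,
          mono hD (NNReal.le_toNNReal_of_coe_le hq1.le)⟩
      · exact Or.inr ⟨fun n hn => hne ⟨_, hn⟩, bot_le.trans_lt hc⟩
    · rintro (⟨q, hq⟩ | ⟨hn, hr⟩)
      · exact (csInf_le (OrderBot.bddBelow _) hq).trans_lt q.2
      · have : {C | ConvolutionBound p c C} = ∅ := by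
          refine Set.eq_empty_of_forall_notMem fun C hC => ?_
          obtain ⟨n, hn'⟩ := exists_nat_ge C
          exact hn n (mono hC hn')
        rw [convolutionNorm, this, NNReal.sInf_empty]
        exact hr
  rw [this]
  refine (MeasurableSet.iUnion fun q => (isClosed_convolutionBound p _).measurableSet).union
    ((MeasurableSet.iUnion fun n => (isClosed_convolutionBound p _).measurableSet).compl.inter
      (MeasurableSet.const _))

/-- The convolution kernel of the operator with symbol `m`. -/
def symbolCoeff (m : UnitAddCircle → ℂ) (n : ℤ) : ℂ :=
  ∫ t : UnitAddCircle, m t * fourier n t ∂AddCircle.haarAddCircle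

/-- Makes the norm depend on `m` only through a countable family of coefficients, a space on which
measurability is accessible. -/
theorem seqMultiplierOp_eq_seqConv {m : UnitAddCircle → ℂ}
    (hm : MemLp m ∞ AddCircle.haarAddCircle) (a : ℤ →₀ ℂ) :
    seqMultiplierOp m a = seqConv (symbolCoeff m) a := by
  funext n
  have hi : Integrable m AddCircle.haarAddCircle := hm.integrable le_top
  have e : ∀ t : UnitAddCircle, m t * seqFourier a t * fourier n t
      = ∑ k ∈ a.support, a k * (m t * fourier (n - k) t) := by
    intro t
    rw [seqFourier, Finsupp.sum, Finset.mul_sum, Finset.sum_mul]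
    refine Finset.sum_congr rfl fun k _ => ?_
    rw [sub_eq_add_neg, fourier_add]
    ring
  simp only [seqMultiplierOp, e, seqConv, Finsupp.sum, symbolCoeff]
  rw [integral_finsetSum]
  · simp only [integral_const_mul]
  · intro k _
    refine Integrable.const_mul ?_ _
    simpa only [smul_eq_mul, mul_comm] using hi.fourier_smul (n - k)

theorem circleMultiplierNorm_eq_convolutionNorm (p : ℝ≥0∞) {m : UnitAddCircle → ℂ}
    (hm : MemLp m ∞ AddCircle.haarAddCircle) :
    circleMultiplierNorm p m = convolutionNorm p (symbolCoeff m) := by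
  simp only [circleMultiplierNorm, convolutionNorm, CircleMultiplierBound, ConvolutionBound,
    seqMultiplierOp_eq_seqConv hm]

/-- For a measurable representative of `Λ` the integrand is jointly measurable in `(x, t)`, as a
`limUnder` of measurable functions, so integrating out `t` leaves a measurable function of `x`. The
change of representative affects only a null set of `t`, the same for all `x`. -/
theorem measurable_symbolCoeff_periodization {Λ : ℝ → ℂ} (hΛ : AEStronglyMeasurable Λ volume) :
    Measurable fun x : ℝ => symbolCoeff (periodization (modulate x Λ)) := by
  obtain ⟨Λ', hΛ', hae⟩ := hΛ
  refine measurable_pi_lambda _ fun n => ?_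
  have e : (fun x : ℝ => symbolCoeff (periodization (modulate x Λ)) n)
      = fun x : ℝ => ∫ t : UnitAddCircle,
        (limUnder atTop fun N : ℕ => periodizationPartialSum (modulate x Λ') N (circleRep t))
          * fourier n t ∂AddCircle.haarAddCircle := by
    funext x
    refine integral_congr_ae ?_
    have h := measurePreserving_circleRep.quasiMeasurePreserving.ae
      (ae_restrict_of_ae (ae_forall_int_translate hae))
    filter_upwards [h] with t ht
    simp only [periodization, liftIco_eq_circleRep, periodizationPartialSum, modulate, ht]
  rw [e]
  refine StronglyMeasurable.measurable (StronglyMeasurable.integral_prod_right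
    (f := fun (x : ℝ) (t : UnitAddCircle) =>
      (limUnder atTop fun N : ℕ => periodizationPartialSum (modulate x Λ') N (circleRep t))
          * fourier n t) ?_)
  refine StronglyMeasurable.mul (StronglyMeasurable.limUnder fun N => ?_)
    ((fourier n).continuous.stronglyMeasurable.comp_measurable measurable_snd)
  refine Measurable.stronglyMeasurable ?_
  have hr : Measurable fun q : ℝ × UnitAddCircle => circleRep q.2 :=
    measurable_circleRep.comp measurable_snd
  have hm := hΛ'.measurable
  simp only [periodizationPartialSum, modulate]
  fun_prop

end SummabilityKernels

end

theorem proposition2p2 (p : ℝ≥0∞) (hp1 : 1 ≤ p) (hp2 : p ≤ 2) :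
    SummabilityKernels.SummabilityKernel p ⊆ SummabilityKernels.FClass p := by
  intro Λ h
  have hp : p ≠ ∞ := (hp2.trans_lt (by simp)).ne
  obtain ⟨C, hC⟩ := SummabilityKernels.SummabilityKernel.exists_circleMultiplierBound hp1 hp h
  have hm := SummabilityKernels.SummabilityKernel.memLp_periodization hp1 h
  refine ⟨SummabilityKernels.SummabilityKernel.memLp_top hp1 h, ae_of_all _ fun x =>
    ⟨SummabilityKernels.SummabilityKernel.hasPeriodization hp1 h x, hm x, C, hC x⟩, ?_⟩
  refine memLp_top_of_bound (Measurable.aestronglyMeasurable ?_) C (ae_of_all _ fun x => ?_)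
  · simp only [SummabilityKernels.circleMultiplierNorm_eq_convolutionNorm p (hm _)]
    exact ((SummabilityKernels.measurable_convolutionNorm p).comp
      (SummabilityKernels.measurable_symbolCoeff_periodization h.1)).coe_nnreal_real
  · rw [Real.norm_of_nonneg (NNReal.coe_nonneg _), NNReal.coe_le_coe]
    exact csInf_le (OrderBot.bddBelow _) (hC x)
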